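/- For $u>0$ let $\zeta(s,u)$ be the Hurwitz zeta function, i.e. the analytic continuation to $s\in\mathbb C\setminus\{1\}$ of $\sum_{n\ge 0}(n+u)^{-s}$ ($\operatorname{Re}s>1$), let $\zeta(s)=\zeta(s,1)$, and let $\zeta^{(m)}(s,u)=\frac{\partial^m}{\partial s^m}\zeta(s,u)$. Let $\gamma$ be Euler's constant and let the Stieltjes constants $\gamma_p$ be defined by $\zeta(s)=\frac1{s-1}+\sum_{p\ge 0}\frac{(-1)^p}{p!}\gamma_p\,(s-1)^p$. Then all series over $n$ below converge, and the following identities hold. For every integer $m\ge 1$ and every real $u>0$, $$-\zeta^{(m)}(0,u)+m\,\zeta^{(m-1)}(0,u)=(-1)^m\sum_{n=0}^{\infty}\frac1{n+1}\sum_{k=0}^n\binom nk(-1)^k(u+k)\log^m(u+k).$$ Moreover: (i) for every integer $m\ge1$, $$-\zeta^{(m)}(0)+m\,\zeta^{(m-1)}(0)=(-1)^m\sum_{n=0}^{\infty}\frac1{n+1}\sum_{k=0}^n\binom nk(-1)^k(1+k)\log^m(1+k);$$ (ii) for every integer $m\ge1$, $$-\zeta^{(m)}(0)+m\,\zeta^{(m-1)}(0)+(-1)^m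 m\,\gamma_{m-1}=(-1)^m\sum_{n=0}^{\infty}\frac1{n+1}\sum_{k=0}^n\binom nk(-1)^k k\log^m(1+k);$$ (iii) $$\sum_{n=0}^{\infty}\frac1{n+1}\sum_{k=0}^n\binom nk(-1)^k k\log(1+k)=\gamma+\tfrac12-\tfrac12\log(2\pi);$$ (iv) $$\sum_{n=0}^{\infty}\frac1{n+1}\sum_{k=0}^n\binom nk(-1)^k k\log^2(1+k)=\tfrac12\log^2(2\pi)+\tfrac14\zeta(2)-\tfrac12\gamma^2+\gamma_1-\log(2\pi).$$ -/

import Mathlib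

open scoped BigOperators Topology Nat

noncomputable section

/-- The Hurwitz zeta function `ζ(s, u)` for every real `u > 0`, continued analytically to
`s ≠ 1`.  Mathlib's function is periodic in the parameter and agrees with `ζ(s, u)` for
`0 < u ≤ 1`; with `N = ⌈u⌉ - 1` we have `0 < u - N ≤ 1`, and
`ζ(s, u) = ζ(s, u - N) - ∑_{0 ≤ j < N} (u - N + j)^(-s)`. -/
def hurwitzZetaPos (u : ℝ) (s : ℂ) : ℂ :=
  HurwitzZeta.hurwitzZeta ((u - (⌈u⌉₊ - 1 : ℕ) : ℝ) : UnitAddCircle) s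
    - ∑ j ∈ Finset.range (⌈u⌉₊ - 1), 1 / ((u - (⌈u⌉₊ - 1 : ℕ) + j : ℝ) : ℂ) ^ s

/-- Where the Dirichlet series converges, `hurwitzZetaPos u s = ∑ 1 / (n + u)^s`. -/
theorem hasSum_hurwitzZetaPos {u : ℝ} (hu : 0 < u) {s : ℂ} (hs : 1 < s.re) :
    HasSum (fun n : ℕ => 1 / ((n : ℂ) + (u : ℂ)) ^ s) (hurwitzZetaPos u s) := by
  have hc : 0 < ⌈u⌉₊ := Nat.ceil_pos.mpr hu
  have h1 : u ≤ (⌈u⌉₊ : ℝ) := Nat.le_ceil u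
  have h2 : (⌈u⌉₊ : ℝ) < u + 1 := Nat.ceil_lt_add_one hu.le
  have h3 : (((⌈u⌉₊ - 1 : ℕ)) : ℝ) = (⌈u⌉₊ : ℝ) - 1 := by
    rw [Nat.cast_sub (by omega)]; simp
  unfold hurwitzZetaPos
  generalize ⌈u⌉₊ - 1 = N at *
  have ha : u - (N : ℝ) ∈ Set.Icc (0 : ℝ) 1 := ⟨by linarith, by linarith⟩
  have h := HurwitzZeta.hasSum_hurwitzZeta_of_one_lt_re ha hs
  rw [← hasSum_nat_add_iff' N] at h
  convert! h using 1
  · funext n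
    congr 2
    push_cast
    ring
  · congr 1
    refine Finset.sum_congr rfl fun j _ => ?_
    congr 2
    push_cast
    ring

/-- `ζ(s, u)` is holomorphic for `s ≠ 1`. -/
theorem differentiableAt_hurwitzZetaPos {u : ℝ} (hu : 0 < u) {s : ℂ} (hs : s ≠ 1) :
    DifferentiableAt ℂ (hurwitzZetaPos u) s := by
  have hc : 0 < ⌈u⌉₊ := Nat.ceil_pos.mpr hu
  have h2 : (⌈u⌉₊ : ℝ) < u + 1 := Nat.ceil_lt_add_one hu.le
  have h3 : (((⌈u⌉₊ - 1 : ℕ)) : ℝ) = (⌈u⌉₊ : ℝ) - 1 := by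
    rw [Nat.cast_sub (by omega)]; simp
  unfold hurwitzZetaPos
  generalize ⌈u⌉₊ - 1 = N at *
  refine (HurwitzZeta.differentiableAt_hurwitzZeta _ hs).sub ?_
  refine DifferentiableAt.fun_sum fun j _ => ?_
  have hpos : (0 : ℝ) < u - N + j := by
    have : (0 : ℝ) ≤ j := Nat.cast_nonneg j
    linarith
  have hne : ((u - N + j : ℝ) : ℂ) ≠ 0 := by exact_mod_cast hpos.ne'
  refine (differentiableAt_const _).div
    (differentiableAt_id.const_cpow (Or.inl hne)) ?_
  rw [Complex.cpow_def_of_ne_zero hne]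
  exact Complex.exp_ne_zero _

/-- `ζ(s, 1) = ζ(s)`. -/
theorem hurwitzZetaPos_one : hurwitzZetaPos 1 = riemannZeta := by
  funext s
  have h : ((1 : ℝ) : UnitAddCircle) = 0 := AddCircle.coe_period 1
  simp [hurwitzZetaPos, h, HurwitzZeta.hurwitzZeta_zero]

/-- The regular part of `ζ` at `s = 1`: the function `ζ(s) - 1 / (s - 1)`, with its removable
singularity at `s = 1` filled in by its limit, Euler's constant. -/
def zetaRegularPart : ℂ → ℂ :=
  Function.update (fun s : ℂ => riemannZeta s - 1 / (s - 1)) 1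
    (Real.eulerMascheroniConstant : ℂ)

/-- The Stieltjes constants `γ_p`, defined by the Laurent expansion
`ζ(s) = 1 / (s - 1) + ∑_p ((-1)^p / p!) γ_p (s - 1)^p`. -/
def stieltjesConstant (p : ℕ) : ℂ :=
  (-1) ^ p * iteratedDeriv p zetaRegularPart 1

theorem differentiable_zetaRegularPart : Differentiable ℂ zetaRegularPart := by
  have hd : DifferentiableOn ℂ zetaRegularPart (Set.univ \ {1}) := by
    intro s hs
    have hs1 : s ≠ 1 := by simpa using hs
    have hsub : s - 1 ≠ 0 := sub_ne_zero.mpr hs1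
    have hF : DifferentiableAt ℂ (fun s : ℂ => riemannZeta s - 1 / (s - 1)) s :=
      (differentiableAt_riemannZeta hs1).sub
        ((differentiableAt_const _).div (differentiableAt_id.sub_const 1) hsub)
    refine (hF.congr_of_eventuallyEq ?_).differentiableWithinAt
    filter_upwards [isOpen_ne.mem_nhds hs1] with z hz
    exact Function.update_of_ne hz _ _
  have hc : ContinuousAt zetaRegularPart 1 :=
    continuousAt_update_same.mpr tendsto_riemannZeta_sub_one_div
  have := (Complex.differentiableOn_compl_singleton_and_continuousAt_iff
    (s := Set.univ) (c := (1 : ℂ)) Filter.univ_mem).mp ⟨hd, hc⟩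
  exact differentiableOn_univ.mp this

/-- The Laurent expansion of `ζ` at `s = 1`. -/
theorem hasSum_stieltjesConstant {s : ℂ} (hs : s ≠ 1) :
    HasSum (fun p : ℕ => (-1) ^ p / (p ! : ℂ) * stieltjesConstant p * (s - 1) ^ p)
      (riemannZeta s - 1 / (s - 1)) := by
  have h := Complex.hasSum_taylorSeries_of_entire differentiable_zetaRegularPart 1 s
  have hv : zetaRegularPart s = riemannZeta s - 1 / (s - 1) := Function.update_of_ne hs _ _
  rw [hv] at h
  convert! h using 1
  funext p
  have h1 : ((-1 : ℂ) ^ p) * (-1) ^ p = 1 := by rw [← mul_pow]; simp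
  simp only [stieltjesConstant, smul_eq_mul]
  calc _ = (((-1 : ℂ) ^ p) * (-1) ^ p) * ((p ! : ℂ)⁻¹ * (s - 1) ^ p
          * iteratedDeriv p zetaRegularPart 1) := by ring
    _ = _ := by rw [h1]; ring

theorem stieltjesConstant_zero :
    stieltjesConstant 0 = (Real.eulerMascheroniConstant : ℂ) := by
  simp [stieltjesConstant, zetaRegularPart]

/-- The `n`-th term `1/(n+1) * ∑_{k=0}^n C(n,k) (-1)^k a_k` of the series
`∑_{n ≥ 0} 1/(n+1) ∑_{k=0}^n C(n,k) (-1)^k a_k`. -/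
def hasseTerm (a : ℕ → ℝ) (n : ℕ) : ℝ :=
  1 / ((n : ℝ) + 1) * ∑ k ∈ Finset.range (n + 1), (n.choose k : ℝ) * (-1) ^ k * a k

end

/-! The identities are derivatives of Hasse's formula `(s - 1) ζ(s, u) = ∑ 1/(n+1) ∑_k C(n,k) (-1)^k
(u+k)^(1-s)`. The `n`-th term times `Γ(s - 1)` is the Mellin transform at `s - 1` of `(1 - e^{-t})^n
e^{-ut} / (n + 1)`. By the logarithmic series these kernels sum to `t e^{-ut} / (1 - e^{-t})`, whose
Mellin transform at `s - 1` is `Γ(s) ζ(s, u)`; dividing by `Γ(s - 1)` gives the formula for `Re s >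
1` (`hasSum_hasseFun_of_one_lt_re`).

The points needed are `s = 0` and `s = 1`. For `n ≥ 2` the kernel is `O(t^2)` at the origin, so its
Mellin transform at `s - 1` converges for `Re s > -1`, and the series converges locally uniformly
there (`tendstoLocallyUniformlyOn_hasseFun`). The identity theorem extends the formula, and
Weierstrass' theorem allows termwise differentiation (`hasSum_iteratedDeriv_hasseFun`).

At `s = 0` the derivatives produce `(u+k) log^m (u+k)`; at `s = 1`, `u = 1` they produce `log^m
(1+k)` and the Stieltjes constants. The difference of the two gives `k log^m (1+k)`. The closed
forms then need `ζ(0)`, `ζ'(0)` and `ζ''(0)`, the last from the functional equation and `Γ''(1)`. -/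

noncomputable section

open MeasureTheory Set Filter Asymptotics

/-! ### The kernels: pointwise sum and bounds. -/

/-- The kernel `(1 - e^{-t})^n e^{-ut} / (n + 1)`, whose Mellin transform is an `n`-th finite
difference of a power. -/
def hasseKernel (u : ℝ) (n : ℕ) (t : ℝ) : ℝ :=
  1 / ((n : ℝ) + 1) * (1 - Real.exp (-t)) ^ n * Real.exp (-u * t)

/-- The `n`-th term of Hasse's series for `(s - 1) ζ(s, u)`. -/
def hasseFun (u : ℝ) (n : ℕ) (s : ℂ) : ℂ :=
  1 / ((n : ℂ) + 1) *
    ∑ k ∈ Finset.range (n + 1), (n.choose k : ℂ) * (-1) ^ k * ((u + k : ℝ) : ℂ) ^ (1 - s)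

theorem one_sub_exp_neg_nonneg {t : ℝ} (ht : 0 ≤ t) : 0 ≤ 1 - Real.exp (-t) := by
  have : Real.exp (-t) ≤ 1 := Real.exp_le_one_iff.mpr (by linarith)
  linarith

theorem one_sub_exp_neg_le (t : ℝ) : 1 - Real.exp (-t) ≤ t := by
  have := Real.add_one_le_exp (-t)
  linarith

theorem one_sub_exp_neg_lt_one (t : ℝ) : 1 - Real.exp (-t) < 1 := by
  have := Real.exp_pos (-t)
  linarith

theorem hasseKernel_nonneg (u : ℝ) (n : ℕ) {t : ℝ} (ht : 0 ≤ t) : 0 ≤ hasseKernel u n t := by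
  have := one_sub_exp_neg_nonneg ht
  unfold hasseKernel
  positivity

theorem continuous_hasseKernel (u : ℝ) (n : ℕ) : Continuous (hasseKernel u n) := by
  unfold hasseKernel
  fun_prop

/-- The series `∑ x^(n+1)/(n+1) = -log (1 - x)` at `x = 1 - e^{-t}`, where the right side is `t`. -/
theorem hasSum_hasseKernel (u : ℝ) {t : ℝ} (ht : 0 < t) :
    HasSum (fun n => hasseKernel u n t) (Real.exp (-u * t) * (t / (1 - Real.exp (-t)))) := by
  set x := 1 - Real.exp (-t) with hx
  have hx0 : 0 < x := by
    have : Real.exp (-t) < 1 := Real.exp_lt_one_iff.mpr (by linarith)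
    linarith
  have h := Real.hasSum_pow_div_log_of_abs_lt_one
    (show |x| < 1 by rw [abs_of_pos hx0]; exact one_sub_exp_neg_lt_one t)
  have h1 : -Real.log (1 - x) = t := by rw [hx]; simp
  rw [h1] at h
  convert! (h.mul_right (Real.exp (-u * t) / x)) using 1
  · funext n
    rw [hasseKernel, ← hx, pow_succ]
    field_simp
  · ring

/-- Pulling `x^2` out of the tail, with `x = 1 - e^{-t} ≤ t`, leaves at most `x^2 · e^{-ut} t / x`.
The factor `t^2` is what moves the abscissa of convergence two units to the left, uniformly in the
number of terms. -/
theorem sum_hasseKernel_add_two_le (u : ℝ) {t : ℝ} (ht : 0 < t) (F : Finset ℕ) :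
    ∑ n ∈ F, hasseKernel u (n + 2) t ≤ t ^ 2 * Real.exp (-u * t) := by
  set x := 1 - Real.exp (-t) with hx
  have hx0 : 0 < x := by
    have : Real.exp (-t) < 1 := Real.exp_lt_one_iff.mpr (by linarith)
    linarith
  have h := (hasSum_hasseKernel u ht).mul_left (x ^ 2)
  calc ∑ n ∈ F, hasseKernel u (n + 2) t ≤ ∑ n ∈ F, x ^ 2 * hasseKernel u n t := by
        refine Finset.sum_le_sum fun n _ => ?_
        rw [hasseKernel, hasseKernel, ← hx]
        have : 1 / (((n + 2 : ℕ) : ℝ) + 1) ≤ 1 / ((n : ℝ) + 1) := by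
          push_cast
          gcongr
          linarith
        calc _ ≤ 1 / ((n : ℝ) + 1) * x ^ (n + 2) * Real.exp (-u * t) := by gcongr
          _ = _ := by ring
    _ ≤ x ^ 2 * (Real.exp (-u * t) * (t / x)) :=
        sum_le_hasSum F (fun n _ => mul_nonneg (by positivity) (hasseKernel_nonneg u n ht.le)) h
    _ = x * t * Real.exp (-u * t) := by field_simp
    _ ≤ t * t * Real.exp (-u * t) := by
        have := one_sub_exp_neg_le t
        gcongr
    _ = _ := by ring

theorem hasseKernel_le (u : ℝ) {j n : ℕ} (hj : j ≤ n) {t : ℝ} (ht : 0 ≤ t) :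
    hasseKernel u n t ≤ t ^ j * Real.exp (-u * t) := by
  have h0 := one_sub_exp_neg_nonneg ht
  have h1 : 1 / ((n : ℝ) + 1) ≤ 1 := by
    rw [div_le_one (by positivity)]
    have : (0 : ℝ) ≤ n := n.cast_nonneg
    linarith
  calc hasseKernel u n t ≤ 1 * (1 - Real.exp (-t)) ^ n * Real.exp (-u * t) := by
        unfold hasseKernel; gcongr
    _ ≤ 1 * (1 - Real.exp (-t)) ^ j * Real.exp (-u * t) := by
        have := pow_le_pow_of_le_one h0 (one_sub_exp_neg_lt_one t).le hj
        gcongr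
    _ ≤ 1 * t ^ j * Real.exp (-u * t) := by
        have := one_sub_exp_neg_le t
        gcongr
    _ = _ := by ring

/-! ### Mellin transforms of the kernels: convergence, summability, holomorphy. -/

theorem integrableOn_rpow_mul_hasseKernel {u : ℝ} (hu : 0 < u) {j n : ℕ} (hj : j ≤ n) {σ : ℝ}
    (hσ : -(j : ℝ) < σ) :
    IntegrableOn (fun t : ℝ => t ^ (σ - 1) * hasseKernel u n t) (Ioi 0) := by
  have h := integrableOn_rpow_mul_exp_neg_mul_rpow (p := 1) (s := σ - 1 + j) (b := u)
    (by linarith) zero_lt_one hu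
  refine h.mono' ?_ ?_
  · refine ContinuousOn.aestronglyMeasurable ?_ measurableSet_Ioi
    exact (continuousOn_id.rpow_const fun t ht => Or.inl (ne_of_gt ht)).mul
      (continuous_hasseKernel u n).continuousOn
  · filter_upwards [ae_restrict_mem measurableSet_Ioi] with t ht
    have ht' : (0 : ℝ) < t := ht
    rw [Real.norm_of_nonneg (mul_nonneg (by positivity) (hasseKernel_nonneg u n ht'.le)),
      Real.rpow_one, Real.rpow_add ht', Real.rpow_natCast, mul_assoc]
    gcongr
    exact hasseKernel_le u hj ht'.le

theorem norm_cpow_mul_hasseKernel (u : ℝ) (n : ℕ) (w : ℂ) {t : ℝ} (ht : 0 < t) :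
    ‖(t : ℂ) ^ (w - 1) • (hasseKernel u n t : ℂ)‖ = t ^ (w.re - 1) * hasseKernel u n t := by
  rw [norm_smul, Complex.norm_cpow_eq_rpow_re_of_pos ht, Complex.norm_real,
    Real.norm_of_nonneg (hasseKernel_nonneg u n ht.le)]
  simp

theorem mellinConvergent_hasseKernel {u : ℝ} (hu : 0 < u) {j n : ℕ} (hj : j ≤ n) {w : ℂ}
    (hw : -(j : ℝ) < w.re) : MellinConvergent (fun t => (hasseKernel u n t : ℂ)) w := by
  refine (integrableOn_rpow_mul_hasseKernel hu hj hw).mono' ?_ ?_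
  · refine ContinuousOn.aestronglyMeasurable ?_ measurableSet_Ioi
    refine ContinuousOn.smul (f := fun t : ℝ => (t : ℂ) ^ (w - 1)) (fun t ht => ?_)
      (Complex.continuous_ofReal.comp (continuous_hasseKernel u n)).continuousOn
    exact (Complex.continuousAt_ofReal_cpow_const _ _ (Or.inr (ne_of_gt ht))).continuousWithinAt
  · filter_upwards [ae_restrict_mem measurableSet_Ioi] with t ht
    exact (norm_cpow_mul_hasseKernel u n w ht).le

/-- The real Mellin transform of the kernel. -/
def hasseMellin (u : ℝ) (n : ℕ) (σ : ℝ) : ℝ := ∫ t in Ioi (0 : ℝ), t ^ (σ - 1) * hasseKernel u n t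

theorem integral_norm_cpow_mul_hasseKernel (u : ℝ) (n : ℕ) (w : ℂ) :
    ∫ t in Ioi (0 : ℝ), ‖(t : ℂ) ^ (w - 1) • (hasseKernel u n t : ℂ)‖ = hasseMellin u n w.re :=
  setIntegral_congr_fun measurableSet_Ioi fun _ ht => norm_cpow_mul_hasseKernel u n w ht

theorem norm_mellin_hasseKernel_le (u : ℝ) (n : ℕ) (w : ℂ) :
    ‖mellin (fun t => (hasseKernel u n t : ℂ)) w‖ ≤ hasseMellin u n w.re := by
  rw [← integral_norm_cpow_mul_hasseKernel]
  exact norm_integral_le_integral_norm _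

theorem hasseMellin_nonneg (u : ℝ) (n : ℕ) (σ : ℝ) : 0 ≤ hasseMellin u n σ :=
  setIntegral_nonneg measurableSet_Ioi fun _ ht =>
    mul_nonneg (Real.rpow_nonneg (le_of_lt ht) _) (hasseKernel_nonneg u n (le_of_lt ht))

theorem summable_hasseMellin_add_two {u : ℝ} (hu : 0 < u) {σ : ℝ} (hσ : -2 < σ) :
    Summable fun n => hasseMellin u (n + 2) σ := by
  have hb := integrableOn_rpow_mul_exp_neg_mul_rpow (p := 1) (s := σ - 1 + 2) (b := u)
    (by linarith) zero_lt_one hu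
  have hi : ∀ n : ℕ, IntegrableOn (fun t : ℝ => t ^ (σ - 1) * hasseKernel u (n + 2) t) (Ioi 0) :=
    fun n => integrableOn_rpow_mul_hasseKernel hu (j := 2) (by omega) (by exact_mod_cast hσ)
  refine summable_of_sum_le (c := ∫ t in Ioi (0 : ℝ), t ^ (σ - 1 + 2) * Real.exp (-u * t ^ (1 : ℝ)))
    (fun n => hasseMellin_nonneg u _ σ) fun F => ?_
  unfold hasseMellin
  rw [← integral_finsetSum F fun n _ => hi n]
  refine setIntegral_mono_on (integrable_finsetSum F fun n _ => hi n) hb measurableSet_Ioi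
    fun t ht => ?_
  have ht' : (0 : ℝ) < t := ht
  rw [← Finset.mul_sum, Real.rpow_one, Real.rpow_add ht', Real.rpow_two, mul_assoc]
  gcongr
  exact sum_hasseKernel_add_two_le u ht' F

theorem summable_hasseMellin {u : ℝ} (hu : 0 < u) {σ : ℝ} (hσ : 0 < σ) :
    Summable fun n => hasseMellin u n σ :=
  (summable_nat_add_iff 2).mp (summable_hasseMellin_add_two hu (by linarith))

/-- The power `t^(σ-1)` is at most `t^(a-1)` for `t ≤ 1` and at most `t^(b-1)` for `t ≥ 1`. This
bounds a whole vertical strip by its two edges. -/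
theorem hasseMellin_le_add {u : ℝ} (hu : 0 < u) {j n : ℕ} (hj : j ≤ n) {a σ b : ℝ}
    (ha : -(j : ℝ) < a) (haσ : a ≤ σ) (hσb : σ ≤ b) :
    hasseMellin u n σ ≤ hasseMellin u n a + hasseMellin u n b := by
  have hi : ∀ τ, a ≤ τ → IntegrableOn (fun t : ℝ => t ^ (τ - 1) * hasseKernel u n t) (Ioi 0) :=
    fun τ hτ => integrableOn_rpow_mul_hasseKernel hu hj (ha.trans_le hτ)
  unfold hasseMellin
  rw [← integral_add (hi a le_rfl) (hi b (haσ.trans hσb))]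
  refine setIntegral_mono_on (hi σ haσ) ((hi a le_rfl).add (hi b (haσ.trans hσb)))
    measurableSet_Ioi fun t ht => ?_
  have ht' : (0 : ℝ) < t := ht
  have hK := hasseKernel_nonneg u n ht'.le
  rw [← add_mul]
  refine mul_le_mul_of_nonneg_right ?_ hK
  rcases le_total t 1 with h | h
  · have := Real.rpow_le_rpow_of_exponent_ge ht' h (show a - 1 ≤ σ - 1 by linarith)
    have := Real.rpow_nonneg ht'.le (b - 1)
    linarith
  · have := Real.rpow_le_rpow_of_exponent_le h (show σ - 1 ≤ b - 1 by linarith)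
    have := Real.rpow_nonneg ht'.le (a - 1)
    linarith

theorem differentiableAt_mellin_hasseKernel {u : ℝ} (hu : 0 < u) {j n : ℕ} (hj : j ≤ n) {w : ℂ}
    (hw : -(j : ℝ) < w.re) :
    DifferentiableAt ℂ (mellin fun t => (hasseKernel u n t : ℂ)) w := by
  refine mellin_differentiableAt_of_isBigO_rpow_exp (a := u) (b := -(j : ℝ)) hu
    ((Complex.continuous_ofReal.comp (continuous_hasseKernel u n)).locallyIntegrable.locallyIntegrableOn
      _) ?_ ?_ hw
  · refine IsBigO.of_bound 1 ?_
    filter_upwards [eventually_ge_atTop 0] with t ht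
    rw [Complex.norm_real, Real.norm_of_nonneg (hasseKernel_nonneg u n ht),
      Real.norm_of_nonneg (Real.exp_pos _).le]
    simpa using hasseKernel_le u (Nat.zero_le n) ht
  · refine IsBigO.of_bound 1 ?_
    filter_upwards [self_mem_nhdsWithin] with t ht
    have ht' : (0 : ℝ) < t := ht
    rw [Complex.norm_real, Real.norm_of_nonneg (hasseKernel_nonneg u n ht'.le), neg_neg,
      Real.rpow_natCast, Real.norm_of_nonneg (by positivity), one_mul]
    refine (hasseKernel_le u hj ht'.le).trans ?_
    have : Real.exp (-u * t) ≤ 1 := Real.exp_le_one_iff.mpr (by nlinarith)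
    have h0 : 0 ≤ t ^ j := by positivity
    nlinarith

/-! ### Terms of Hasse's series as Mellin transforms. -/

theorem hasseKernel_eq_sum (u : ℝ) (n : ℕ) (t : ℝ) :
    hasseKernel u n t = ∑ k ∈ Finset.range (n + 1),
      1 / ((n : ℝ) + 1) * ((n.choose k : ℝ) * (-1) ^ k) * Real.exp (-(u + k) * t) := by
  have h : (1 - Real.exp (-t)) ^ n = ∑ k ∈ Finset.range (n + 1),
      (n.choose k : ℝ) * (-1) ^ k * Real.exp (-t) ^ k := by
    rw [sub_eq_neg_add, add_pow]
    refine Finset.sum_congr rfl fun k _ => ?_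
    rw [neg_pow]
    ring
  rw [hasseKernel, h, Finset.mul_sum, Finset.sum_mul]
  refine Finset.sum_congr rfl fun k _ => ?_
  rw [← Real.exp_nat_mul, show -(u + k) * t = k * -t + -u * t by ring, Real.exp_add]
  ring

theorem mellin_hasseKernel {u : ℝ} (hu : 0 < u) (n : ℕ) {w : ℂ} (hw : 0 < w.re) :
    mellin (fun t => (hasseKernel u n t : ℂ)) w = Complex.Gamma w * hasseFun u n (w + 1) := by
  set a : ℕ → ℂ := fun k => 1 / ((n : ℂ) + 1) * ((n.choose k : ℂ) * (-1) ^ k) with ha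
  -- Coefficients vanish beyond `n`, so the finite sum has the shape of the series in
  -- `hasSum_mellin`.
  have hz : ∀ k ∉ Finset.range (n + 1), a k = 0 := fun k hk => by
    rw [Finset.mem_range, not_lt] at hk
    simp [ha, Nat.choose_eq_zero_of_lt (show n < k by omega)]
  have h := hasSum_mellin (a := a) (p := fun k => u + k)
    (F := fun t => (hasseKernel u n t : ℂ)) (s := w) (fun k => Or.inr (by positivity)) hw ?_ ?_
  · have h2 : HasSum (fun k => Complex.Gamma w * a k / ((u + k : ℝ) : ℂ) ^ w)
        (∑ k ∈ Finset.range (n + 1), Complex.Gamma w * a k / ((u + k : ℝ) : ℂ) ^ w) :=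
      hasSum_sum_of_ne_finset_zero fun k hk => by simp [hz k hk]
    rw [h.unique h2, hasseFun, Finset.mul_sum, Finset.mul_sum]
    refine Finset.sum_congr rfl fun k _ => ?_
    rw [show 1 - (w + 1) = -w by ring, Complex.cpow_neg]
    simp only [ha]
    ring
  · intro t _
    rw [hasseKernel_eq_sum]
    push_cast
    convert hasSum_sum_of_ne_finset_zero (s := Finset.range (n + 1)) (L := .unconditional ℕ)
      (f := fun k => a k * ((Real.exp (-(u + k) * t) : ℝ) : ℂ))
      fun k hk => by simp [hz k hk] using 2 <;>
    simp [ha]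
  · exact summable_of_ne_finset_zero (s := Finset.range (n + 1)) fun k hk => by simp [hz k hk]

theorem differentiable_hasseFun {u : ℝ} (hu : 0 < u) (n : ℕ) : Differentiable ℂ (hasseFun u n) := by
  unfold hasseFun
  refine (differentiable_const _).mul (Differentiable.fun_sum fun k _ => ?_)
  refine (differentiable_const _).mul fun s => ?_
  have hne : ((u + k : ℝ) : ℂ) ≠ 0 := by
    have : u + k ≠ 0 := by positivity
    exact_mod_cast this
  exact ((differentiableAt_const _).sub differentiableAt_id).const_cpow (Or.inl hne)

theorem isPreconnected_re_gt (a : ℝ) : IsPreconnected {s : ℂ | a < s.re} :=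
  (convex_halfSpace_re_gt a).isPreconnected

theorem isOpen_re_gt (a : ℝ) : IsOpen {s : ℂ | a < s.re} :=
  isOpen_lt continuous_const Complex.continuous_re

theorem hasseFun_eq_of_one_lt_re {u : ℝ} (hu : 0 < u) (n : ℕ) {s : ℂ} (hs : 1 < s.re) :
    hasseFun u n s =
      (Complex.Gamma (s - 1))⁻¹ * mellin (fun t => (hasseKernel u n t : ℂ)) (s - 1) := by
  have hw : 0 < (s - 1).re := by simpa using hs
  rw [mellin_hasseKernel hu n hw, sub_add_cancel,
    inv_mul_cancel_left₀ (Complex.Gamma_ne_zero_of_re_pos hw)]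

/-- Both sides are holomorphic on the half-plane, `1/Γ` being entire, and they agree for `Re s > 1`.
-/
theorem hasseFun_eq {u : ℝ} (hu : 0 < u) {j n : ℕ} (hj : j ≤ n) {s : ℂ}
    (hs : 1 - (j : ℝ) < s.re) :
    hasseFun u n s =
      (Complex.Gamma (s - 1))⁻¹ * mellin (fun t => (hasseKernel u n t : ℂ)) (s - 1) := by
  have hU := isOpen_re_gt (1 - (j : ℝ))
  have hj0 : (0 : ℝ) ≤ j := j.cast_nonneg
  have h1 : AnalyticOnNhd ℂ (hasseFun u n) {s : ℂ | 1 - (j : ℝ) < s.re} :=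
    (differentiable_hasseFun hu n).differentiableOn.analyticOnNhd hU
  have h2 : AnalyticOnNhd ℂ (fun s => (Complex.Gamma (s - 1))⁻¹ *
      mellin (fun t => (hasseKernel u n t : ℂ)) (s - 1)) {s : ℂ | 1 - (j : ℝ) < s.re} := by
    refine DifferentiableOn.analyticOnNhd (fun z hz => ?_) hU
    have hz' : -(j : ℝ) < (z - 1).re := by
      have : 1 - (j : ℝ) < z.re := hz
      simp only [Complex.sub_re, Complex.one_re]
      linarith
    have hsub : DifferentiableAt ℂ (fun s : ℂ => s - 1) z := differentiableAt_id.sub_const 1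
    exact (((Complex.differentiable_one_div_Gamma _).comp z hsub).mul
      ((differentiableAt_mellin_hasseKernel hu hj hz').comp z hsub)).differentiableWithinAt
  refine h1.eqOn_of_preconnected_of_eventuallyEq h2 (isPreconnected_re_gt _) (z₀ := 2) ?_ ?_ hs
  · simp only [mem_ofPred_eq, Complex.re_ofNat]
    linarith
  · filter_upwards [(isOpen_re_gt 1).mem_nhds (show (1 : ℝ) < (2 : ℂ).re by simp)] with z hz
    exact hasseFun_eq_of_one_lt_re hu n hz

/-- Weierstrass M-test on a compact set: `1/Γ(s - 1)` is bounded there, and the Mellin transforms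
are dominated by their values at the extreme real parts. -/
theorem tendstoLocallyUniformlyOn_hasseFun {u : ℝ} (hu : 0 < u) :
    TendstoLocallyUniformlyOn (fun (N : Finset ℕ) s => ∑ n ∈ N, hasseFun u n s)
      (fun s => ∑' n, hasseFun u n s) atTop {s : ℂ | -1 < s.re} := by
  rw [tendstoLocallyUniformlyOn_iff_forall_isCompact (isOpen_re_gt _)]
  intro K hKU hK
  rcases K.eq_empty_or_nonempty with rfl | hne
  · exact tendstoUniformlyOn_empty
  obtain ⟨z₁, hz₁, h₁⟩ := hK.exists_isMinOn hne Complex.continuous_re.continuousOn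
  obtain ⟨z₂, hz₂, h₂⟩ := hK.exists_isMaxOn hne Complex.continuous_re.continuousOn
  have hcont : Continuous fun s : ℂ => (Complex.Gamma (s - 1))⁻¹ :=
    Complex.differentiable_one_div_Gamma.continuous.comp (continuous_id.sub continuous_const)
  obtain ⟨C, hC⟩ := hK.exists_bound_of_continuousOn hcont.continuousOn
  have hC0 : 0 ≤ C := (norm_nonneg _).trans (hC z₁ hz₁)
  have hz₁' : -1 < z₁.re := hKU hz₁
  have hz₂' : -1 < z₂.re := hKU hz₂
  -- The bound is needed only for `n ≥ 2`; the integrals for `n = 0, 1` may diverge, but finitely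
  -- many terms do not matter.
  refine tendstoUniformlyOn_tsum_of_cofinite_eventually
    (u := fun n => C * (hasseMellin u n (z₁.re - 1) + hasseMellin u n (z₂.re - 1))) ?_ ?_
  · refine Summable.mul_left _ (Summable.add ?_ ?_) <;>
    refine (summable_nat_add_iff 2).mp (summable_hasseMellin_add_two hu (by linarith))
  · rw [Nat.cofinite_eq_atTop]
    filter_upwards [eventually_ge_atTop 2] with n hn s hs
    have hs' : -1 < s.re := hKU hs
    rw [hasseFun_eq hu hn (by push_cast; linarith), norm_mul]
    refine mul_le_mul (hC s hs) ?_ (norm_nonneg _) hC0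
    refine (norm_mellin_hasseKernel_le u n _).trans ?_
    have ha : z₁.re ≤ s.re := h₁ hs
    have hb : s.re ≤ z₂.re := h₂ hs
    refine hasseMellin_le_add hu hn ?_ ?_ ?_ <;>
      simp only [Complex.sub_re, Complex.one_re, Nat.cast_ofNat] <;> linarith

/-! ### Hasse's formula for `Re s > 1`. -/

theorem hasSum_exp_neg_add_mul (u : ℝ) {t : ℝ} (ht : 0 < t) :
    HasSum (fun k : ℕ => Real.exp (-(k + u) * t)) (Real.exp (-u * t) / (1 - Real.exp (-t))) := by
  have h := (hasSum_geometric_of_lt_one (Real.exp_pos (-t)).le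
    (Real.exp_lt_one_iff.mpr (by linarith))).mul_left (Real.exp (-u * t))
  rw [div_eq_mul_inv]
  convert! h using 1
  funext k
  rw [← Real.exp_nat_mul, ← Real.exp_add]
  congr 1
  ring

theorem mellin_exp_div_one_sub_exp {u : ℝ} (hu : 0 < u) {s : ℂ} (hs : 1 < s.re) :
    mellin (fun t => ((Real.exp (-u * t) / (1 - Real.exp (-t)) : ℝ) : ℂ)) s =
      Complex.Gamma s * hurwitzZetaPos u s := by
  have h0 : 0 < s.re := by linarith
  have hz := hasSum_hurwitzZetaPos hu hs
  have h := hasSum_mellin (a := fun _ : ℕ => 1) (p := fun k => k + u)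
    (F := fun t => ((Real.exp (-u * t) / (1 - Real.exp (-t)) : ℝ) : ℂ)) (s := s)
    (fun k => Or.inr (by positivity)) h0 ?_ ?_
  · refine h.unique ?_
    convert! hz.mul_left (Complex.Gamma s) using 1
    funext k
    push_cast
    ring
  · intro t ht
    have := (Complex.hasSum_ofReal ).mpr (hasSum_exp_neg_add_mul u ht)
    simpa only [one_mul] using this
  · have := hz.summable.norm
    refine this.congr fun k => ?_
    have hk : (0 : ℝ) < k + u := by positivity
    rw [norm_div, norm_one, show (k : ℂ) + u = ((k + u : ℝ) : ℂ) by push_cast; rfl,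
      Complex.norm_cpow_eq_rpow_re_of_pos hk]

/-- Sum and integral are exchanged by absolute convergence. The factor `t` in the summed kernel
turns the Mellin transform at `s - 1` into one at `s`, and `Γ(s) = (s - 1) Γ(s - 1)` supplies the
factor `s - 1`. -/
theorem hasSum_hasseFun_of_one_lt_re {u : ℝ} (hu : 0 < u) {s : ℂ} (hs : 1 < s.re) :
    HasSum (fun n => hasseFun u n s) ((s - 1) * hurwitzZetaPos u s) := by
  have hw : 0 < (s - 1).re := by simpa using hs
  have hw0 : s - 1 ≠ 0 := fun h => by simp [h] at hw
  have hG := Complex.Gamma_ne_zero_of_re_pos hw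
  have h := hasSum_integral_of_summable_integral_norm (μ := volume.restrict (Ioi (0 : ℝ)))
    (F := fun n t => (t : ℂ) ^ (s - 1 - 1) • (hasseKernel u n t : ℂ))
    (fun n => mellinConvergent_hasseKernel hu (Nat.zero_le n) (by simpa using hs)) (by
      simp only [integral_norm_cpow_mul_hasseKernel]
      exact summable_hasseMellin hu hw)
  have heq : ∫ t in Ioi (0 : ℝ), ∑' n, (t : ℂ) ^ (s - 1 - 1) • (hasseKernel u n t : ℂ) =
      Complex.Gamma s * hurwitzZetaPos u s := by
    rw [← mellin_exp_div_one_sub_exp hu hs, mellin]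
    refine setIntegral_congr_fun measurableSet_Ioi fun t ht => ?_
    have ht' : (0 : ℝ) < t := ht
    have ht0 : (t : ℂ) ≠ 0 := by exact_mod_cast ht'.ne'
    have hk := ((Complex.hasSum_ofReal ).mpr (hasSum_hasseKernel u ht')).mul_left
      ((t : ℂ) ^ (s - 1 - 1))
    simp only [smul_eq_mul]
    rw [hk.tsum_eq]
    conv_rhs => rw [show s - 1 = s - 1 - 1 + 1 by ring, Complex.cpow_add _ _ ht0, Complex.cpow_one]
    push_cast
    ring
  rw [heq] at h
  have h2 := h.mul_left (Complex.Gamma (s - 1))⁻¹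
  convert! h2 using 1
  · funext n
    exact hasseFun_eq_of_one_lt_re hu n hs
  · have := Complex.Gamma_add_one (s - 1) hw0
    rw [sub_add_cancel] at this
    rw [this]
    field_simp

/-! ### Continuation of Hasse's formula to `Re s > -1`. -/

theorem tendsto_sub_one_mul_hurwitzZetaPos {u : ℝ} (hu : 0 < u) :
    Tendsto (fun s => (s - 1) * hurwitzZetaPos u s) (𝓝[≠] 1) (𝓝 1) := by
  have hc : 0 < ⌈u⌉₊ := Nat.ceil_pos.mpr hu
  have h2 : (⌈u⌉₊ : ℝ) < u + 1 := Nat.ceil_lt_add_one hu.le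
  have h3 : (((⌈u⌉₊ - 1 : ℕ)) : ℝ) = (⌈u⌉₊ : ℝ) - 1 := by
    rw [Nat.cast_sub (by omega)]; simp
  unfold hurwitzZetaPos
  generalize ⌈u⌉₊ - 1 = N at *
  have hcont : ContinuousAt (fun s : ℂ => (s - 1) *
      ∑ j ∈ Finset.range N, 1 / ((u - N + j : ℝ) : ℂ) ^ s) 1 := by
    refine (continuousAt_id.sub continuousAt_const).mul (tendsto_finsetSum _ fun j _ => ?_)
    have hpos : (0 : ℝ) < u - N + j := by
      have : (0 : ℝ) ≤ j := Nat.cast_nonneg j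
      linarith
    have hne : ((u - N + j : ℝ) : ℂ) ≠ 0 := by exact_mod_cast hpos.ne'
    refine ContinuousAt.div continuousAt_const (continuousAt_const_cpow hne) ?_
    rw [Complex.cpow_def_of_ne_zero hne]
    exact Complex.exp_ne_zero _
  have := (HurwitzZeta.hurwitzZeta_residue_one ((u - N : ℝ) : UnitAddCircle)).sub
    (hcont.tendsto.mono_left nhdsWithin_le_nhds)
  simpa [mul_sub] using this

/-- The function `(s - 1) ζ(s, u)` with its removable singularity at `s = 1` filled in. -/
def hurwitzZetaMulSubOne (u : ℝ) : ℂ → ℂ :=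
  Function.update (fun s : ℂ => (s - 1) * hurwitzZetaPos u s) 1 1

theorem hurwitzZetaMulSubOne_of_ne (u : ℝ) {s : ℂ} (hs : s ≠ 1) :
    hurwitzZetaMulSubOne u s = (s - 1) * hurwitzZetaPos u s :=
  Function.update_of_ne hs _ _

theorem differentiable_hurwitzZetaMulSubOne {u : ℝ} (hu : 0 < u) :
    Differentiable ℂ (hurwitzZetaMulSubOne u) := by
  refine differentiableOn_univ.mp ((Complex.differentiableOn_compl_singleton_and_continuousAt_iff
    (s := univ) (c := (1 : ℂ)) univ_mem).mp ⟨fun s hs => ?_, ?_⟩)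
  · have hs1 : s ≠ 1 := by simpa using hs
    have hF : DifferentiableAt ℂ (fun s : ℂ => (s - 1) * hurwitzZetaPos u s) s :=
      (differentiableAt_id.sub_const 1).mul (differentiableAt_hurwitzZetaPos hu hs1)
    refine (hF.congr_of_eventuallyEq ?_).differentiableWithinAt
    filter_upwards [isOpen_ne.mem_nhds hs1] with z hz
    exact hurwitzZetaMulSubOne_of_ne u hz
  · exact continuousAt_update_same.mpr (tendsto_sub_one_mul_hurwitzZetaPos hu)

theorem tsum_hasseFun {u : ℝ} (hu : 0 < u) {s : ℂ} (hs : -1 < s.re) :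
    ∑' n, hasseFun u n s = hurwitzZetaMulSubOne u s := by
  have hU := isOpen_re_gt (-1)
  have h1 : AnalyticOnNhd ℂ (fun s => ∑' n, hasseFun u n s) {s : ℂ | -1 < s.re} :=
    ((tendstoLocallyUniformlyOn_hasseFun hu).differentiableOn (Eventually.of_forall fun N =>
      (Differentiable.fun_sum fun n _ => differentiable_hasseFun hu n).differentiableOn)
      hU).analyticOnNhd hU
  have h2 : AnalyticOnNhd ℂ (hurwitzZetaMulSubOne u) {s : ℂ | -1 < s.re} :=
    (differentiable_hurwitzZetaMulSubOne hu).differentiableOn.analyticOnNhd hU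
  refine h1.eqOn_of_preconnected_of_eventuallyEq h2 (isPreconnected_re_gt _) (z₀ := 2)
    (by simp only [mem_ofPred_eq, Complex.re_ofNat]; norm_num) ?_ hs
  filter_upwards [(isOpen_re_gt 1).mem_nhds (show (1 : ℝ) < (2 : ℂ).re by simp)] with z hz
  have hz1 : z ≠ 1 := fun h => by simp [h] at hz
  rw [(hasSum_hasseFun_of_one_lt_re hu hz).tsum_eq, hurwitzZetaMulSubOne_of_ne u hz1]

/-! ### Termwise differentiation. -/

theorem tendstoLocallyUniformlyOn_iteratedDeriv {ι : Type*} {p : Filter ι} {F : ι → ℂ → ℂ}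
    {f : ℂ → ℂ} {U : Set ℂ} (hf : TendstoLocallyUniformlyOn F f p U)
    (hF : ∀ i, DifferentiableOn ℂ (F i) U) (hU : IsOpen U) (m : ℕ) :
    TendstoLocallyUniformlyOn (fun i => iteratedDeriv m (F i)) (iteratedDeriv m f) p U := by
  have hd : ∀ i m, DifferentiableOn ℂ (iteratedDeriv m (F i)) U := fun i m => by
    induction m with
    | zero => simpa using hF i
    | succ m ih =>
      rw [iteratedDeriv_succ]
      exact ih.deriv hU
  induction m with
  | zero => simpa using hf
  | succ m ih =>
    simp only [iteratedDeriv_succ]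
    exact ih.deriv (Eventually.of_forall fun i => hd i m) hU

theorem hasSum_iteratedDeriv_hasseFun {u : ℝ} (hu : 0 < u) (m : ℕ) {s : ℂ}
    (hs : -1 < s.re) :
    HasSum (fun n => iteratedDeriv m (hasseFun u n) s)
      (iteratedDeriv m (hurwitzZetaMulSubOne u) s) := by
  have hU := isOpen_re_gt (-1)
  have h := (tendstoLocallyUniformlyOn_iteratedDeriv (tendstoLocallyUniformlyOn_hasseFun hu) (fun N =>
    (Differentiable.fun_sum fun n _ => differentiable_hasseFun hu n).differentiableOn)
      hU m).tendsto_at hs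
  have he : (fun s => ∑' n, hasseFun u n s) =ᶠ[𝓝 s] hurwitzZetaMulSubOne u := by
    filter_upwards [hU.mem_nhds hs] with z hz
    exact tsum_hasseFun hu hz
  rw [he.iteratedDeriv_eq] at h
  rw [HasSum, SummationFilter.unconditional_filter]
  refine h.congr fun N => ?_
  exact iteratedDeriv_fun_sum fun n _ => (differentiable_hasseFun hu n).contDiff.contDiffAt

theorem iteratedDeriv_cpow_one_sub {x : ℝ} (hx : 0 < x) (m : ℕ) (s : ℂ) :
    iteratedDeriv m (fun s : ℂ => (x : ℂ) ^ (1 - s)) s =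
      (-(Real.log x : ℂ)) ^ m * (x : ℂ) ^ (1 - s) := by
  have hx0 : (x : ℂ) ≠ 0 := by exact_mod_cast hx.ne'
  have h : (fun s : ℂ => (x : ℂ) ^ (1 - s)) =
      fun s => (x : ℂ) * Complex.exp (-(Real.log x : ℂ) * s) := by
    funext s
    rw [sub_eq_add_neg, Complex.cpow_add _ _ hx0, Complex.cpow_one, Complex.cpow_def_of_ne_zero hx0,
      Complex.ofReal_log hx.le]
    ring_nf
  rw [congrFun h s, h, iteratedDeriv_const_mul_field, iteratedDeriv_cexp_const_mul]
  ring

theorem iteratedDeriv_hasseFun {u : ℝ} (hu : 0 < u) (n m : ℕ) (s : ℂ) :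
    iteratedDeriv m (hasseFun u n) s = 1 / ((n : ℂ) + 1) *
      ∑ k ∈ Finset.range (n + 1), (n.choose k : ℂ) * (-1) ^ k *
        ((-(Real.log (u + k) : ℂ)) ^ m * ((u + k : ℝ) : ℂ) ^ (1 - s)) := by
  unfold hasseFun
  rw [iteratedDeriv_const_mul_field, iteratedDeriv_fun_sum]
  · congr 1
    refine Finset.sum_congr rfl fun k _ => ?_
    rw [iteratedDeriv_const_mul_field, iteratedDeriv_cpow_one_sub (by positivity)]
  · intro k _
    have hne : ((u + k : ℝ) : ℂ) ≠ 0 := by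
      have : u + k ≠ 0 := by positivity
      exact_mod_cast this
    have : Differentiable ℂ fun s : ℂ => (n.choose k : ℂ) * (-1) ^ k * ((u + k : ℝ) : ℂ) ^ (1 - s) :=
      (differentiable_const _).mul fun s =>
        ((differentiableAt_const _).sub differentiableAt_id).const_cpow (Or.inl hne)
    exact this.contDiff.contDiffAt

theorem iteratedDeriv_hasseFun_zero {u : ℝ} (hu : 0 < u) (n m : ℕ) :
    iteratedDeriv m (hasseFun u n) 0 =
      (-1) ^ m * (hasseTerm (fun k => (u + k) * Real.log (u + k) ^ m) n : ℂ) := by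
  rw [iteratedDeriv_hasseFun hu, hasseTerm]
  push_cast
  rw [mul_left_comm, Finset.mul_sum _ _ ((-1 : ℂ) ^ m)]
  congr 1
  refine Finset.sum_congr rfl fun k _ => ?_
  rw [sub_zero, Complex.cpow_one, neg_pow]
  ring

theorem iteratedDeriv_hasseFun_one {u : ℝ} (hu : 0 < u) (n m : ℕ) :
    iteratedDeriv m (hasseFun u n) 1 =
      (-1) ^ m * (hasseTerm (fun k => Real.log (u + k) ^ m) n : ℂ) := by
  rw [iteratedDeriv_hasseFun hu, hasseTerm]
  push_cast
  rw [mul_left_comm, Finset.mul_sum _ _ ((-1 : ℂ) ^ m)]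
  congr 1
  refine Finset.sum_congr rfl fun k _ => ?_
  rw [sub_self, Complex.cpow_zero, neg_pow]
  ring

theorem neg_one_pow_mul_self (m : ℕ) : ((-1 : ℂ) ^ m) * (-1) ^ m = 1 := by
  rw [← mul_pow]; simp

theorem hasSum_ofReal_of_neg_one_pow_mul {m : ℕ} {f : ℕ → ℝ} {z : ℂ}
    (h : HasSum (fun n => (-1) ^ m * (f n : ℂ)) z) : HasSum (fun n => (f n : ℂ)) ((-1) ^ m * z) := by
  simpa only [← mul_assoc, neg_one_pow_mul_self, one_mul] using h.mul_left ((-1 : ℂ) ^ m)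

theorem summable_and_tsum_of_hasSum_ofReal {f : ℕ → ℝ} {z : ℂ}
    (h : HasSum (fun n => (f n : ℂ)) z) : Summable f ∧ ((∑' n, f n : ℝ) : ℂ) = z := by
  refine ⟨?_, ?_⟩
  · exact Complex.summable_ofReal.mp h.summable
  · rw [Complex.ofReal_tsum, h.tsum_eq]

/-! ### Derivatives at `0` and `1`, and the resulting series. -/

theorem iteratedDeriv_succ_sub_mul (a : ℂ) {g : ℂ → ℂ} {s : ℂ} (m : ℕ)
    (hg : ContDiffAt ℂ (m + 1 : ℕ) g s) :
    iteratedDeriv (m + 1) (fun s => (s - a) * g s) s =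
      (s - a) * iteratedDeriv (m + 1) g s + (m + 1) * iteratedDeriv m g s := by
  have h1 : deriv (fun s : ℂ => s - a) = fun _ => 1 := by
    funext z
    simp
  have h2 : ∀ i, iteratedDeriv (i + 1 + 1) (fun s : ℂ => s - a) s = 0 := fun i => by
    rw [iteratedDeriv_succ', iteratedDeriv_succ', h1]
    simp
  rw [iteratedDeriv_fun_mul (by fun_prop) hg, Finset.sum_range_succ', Finset.sum_range_succ']
  simp [h2, iteratedDeriv_one]
  ring

theorem iteratedDeriv_hurwitzZetaMulSubOne_zero {u : ℝ} (hu : 0 < u) {m : ℕ} (hm : 1 ≤ m) :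
    iteratedDeriv m (hurwitzZetaMulSubOne u) 0 =
      -iteratedDeriv m (hurwitzZetaPos u) 0 + m * iteratedDeriv (m - 1) (hurwitzZetaPos u) 0 := by
  obtain ⟨m, rfl⟩ := Nat.exists_eq_add_of_le' hm
  have he : hurwitzZetaMulSubOne u =ᶠ[𝓝 0] fun s => (s - 1) * hurwitzZetaPos u s := by
    filter_upwards [isOpen_ne.mem_nhds (zero_ne_one (α := ℂ))] with z hz
    exact hurwitzZetaMulSubOne_of_ne u hz
  have hd : DifferentiableOn ℂ (hurwitzZetaPos u) {1}ᶜ := fun s hs =>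
    (differentiableAt_hurwitzZetaPos hu hs).differentiableWithinAt
  have ha : AnalyticAt ℂ (hurwitzZetaPos u) 0 :=
    hd.analyticAt (isOpen_compl_singleton.mem_nhds (zero_ne_one (α := ℂ)))
  rw [he.iteratedDeriv_eq, iteratedDeriv_succ_sub_mul 1 m ha.contDiffAt]
  simp

theorem hurwitzZetaMulSubOne_one_eq :
    hurwitzZetaMulSubOne 1 = fun s => 1 + (s - 1) * zetaRegularPart s := by
  funext s
  by_cases hs : s = 1
  · subst hs
    simp [hurwitzZetaMulSubOne]
  · have : s - 1 ≠ 0 := sub_ne_zero.mpr hs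
    rw [hurwitzZetaMulSubOne_of_ne _ hs, hurwitzZetaPos_one, zetaRegularPart,
      Function.update_of_ne hs]
    field_simp
    ring

theorem iteratedDeriv_hurwitzZetaMulSubOne_one {m : ℕ} (hm : 1 ≤ m) :
    iteratedDeriv m (hurwitzZetaMulSubOne 1) 1 = (-1) ^ (m - 1) * m * stieltjesConstant (m - 1) := by
  obtain ⟨m, rfl⟩ := Nat.exists_eq_add_of_le' hm
  rw [hurwitzZetaMulSubOne_one_eq, iteratedDeriv_const_add (by omega),
    iteratedDeriv_succ_sub_mul 1 m differentiable_zetaRegularPart.contDiff.contDiffAt,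
    stieltjesConstant]
  simp only [Nat.add_sub_cancel]
  push_cast
  linear_combination (-(m + 1) * iteratedDeriv m zetaRegularPart 1) * neg_one_pow_mul_self m

theorem hasSum_hasseTerm_mul_log_pow {u : ℝ} (hu : 0 < u) {m : ℕ} (hm : 1 ≤ m) :
    HasSum (fun n => (hasseTerm (fun k => (u + k) * Real.log (u + k) ^ m) n : ℂ))
      ((-1) ^ m * (-iteratedDeriv m (hurwitzZetaPos u) 0 +
        m * iteratedDeriv (m - 1) (hurwitzZetaPos u) 0)) := by
  refine hasSum_ofReal_of_neg_one_pow_mul ?_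
  simp only [← iteratedDeriv_hasseFun_zero hu, ← iteratedDeriv_hurwitzZetaMulSubOne_zero hu hm]
  exact hasSum_iteratedDeriv_hasseFun hu m (by simp)

theorem hasSum_hasseTerm_log_pow {m : ℕ} (hm : 1 ≤ m) :
    HasSum (fun n => (hasseTerm (fun k => Real.log (1 + k) ^ m) n : ℂ))
      (-(m * stieltjesConstant (m - 1))) := by
  have h := hasSum_iteratedDeriv_hasseFun one_pos m (s := 1) (by
    rw [Complex.one_re]; norm_num)
  simp only [iteratedDeriv_hasseFun_one one_pos, iteratedDeriv_hurwitzZetaMulSubOne_one hm] at h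
  convert! hasSum_ofReal_of_neg_one_pow_mul h using 1
  obtain ⟨m, rfl⟩ := Nat.exists_eq_add_of_le' hm
  simp only [Nat.add_sub_cancel]
  linear_combination (((m + 1 : ℕ) : ℂ) * stieltjesConstant m) * neg_one_pow_mul_self m

/-- Since `k = (1 + k) - 1`, this is the expansion at `s = 0` minus the one at `s = 1`. -/
theorem hasSum_hasseTerm_index_mul_log_pow {m : ℕ} (hm : 1 ≤ m) :
    HasSum (fun n => (hasseTerm (fun k => k * Real.log (1 + k) ^ m) n : ℂ))
      ((-1) ^ m * (-iteratedDeriv m riemannZeta 0 + m * iteratedDeriv (m - 1) riemannZeta 0) +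
        m * stieltjesConstant (m - 1)) := by
  have h := (hasSum_hasseTerm_mul_log_pow one_pos hm).sub (hasSum_hasseTerm_log_pow hm)
  rw [hurwitzZetaPos_one, sub_neg_eq_add] at h
  convert! h using 1
  funext n
  rw [← Complex.ofReal_sub, hasseTerm, hasseTerm, hasseTerm, ← mul_sub, ← Finset.sum_sub_distrib]
  congr 2
  refine Finset.sum_congr rfl fun k _ => ?_
  ring

/-! ### The values `Γ''(1)` and `ζ''(0)`. -/

theorem iteratedDeriv_two_fun_mul {f g : ℂ → ℂ} {s : ℂ} (hf : ContDiffAt ℂ (2 : ℕ) f s)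
    (hg : ContDiffAt ℂ (2 : ℕ) g s) :
    iteratedDeriv 2 (fun s => f s * g s) s =
      f s * iteratedDeriv 2 g s + 2 * (deriv f s * deriv g s) + iteratedDeriv 2 f s * g s := by
  rw [iteratedDeriv_fun_mul hf hg]
  simp [Finset.sum_range_succ, iteratedDeriv_one]
  ring

theorem iteratedDeriv_three_sin_mul (c : ℂ) {g : ℂ → ℂ} (hg : ContDiffAt ℂ (3 : ℕ) g 0) :
    iteratedDeriv 3 (fun t => Complex.sin (c * t) * g t) 0 =
      3 * c * iteratedDeriv 2 g 0 - c ^ 3 * g 0 := by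
  have h (k : ℕ) : iteratedDeriv k (fun t => Complex.sin (c * t)) 0 =
      c ^ k * iteratedDeriv k Complex.sin 0 := by
    rw [iteratedDeriv_comp_const_mul Complex.contDiff_sin]
    simp
  rw [iteratedDeriv_fun_mul (by fun_prop) hg]
  simp [Finset.sum_range_succ, h, iteratedDeriv_succ, Nat.choose]
  ring

theorem iteratedDeriv_succ_id_mul {g : ℂ → ℂ} (m : ℕ) (hg : ContDiffAt ℂ (m + 1 : ℕ) g 0) :
    iteratedDeriv (m + 1) (fun s => s * g s) 0 = (m + 1) * iteratedDeriv m g 0 := by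
  have := iteratedDeriv_succ_sub_mul 0 m hg
  simpa using this

theorem analyticAt_Gamma_one : AnalyticAt ℂ Complex.Gamma 1 := by
  have hU : IsOpen {s : ℂ | 0 < s.re} := isOpen_lt continuous_const Complex.continuous_re
  have hd : DifferentiableOn ℂ Complex.Gamma {s : ℂ | 0 < s.re} := fun s hs =>
    (Complex.differentiableAt_Gamma s fun m h => by
      have hs' : 0 < s.re := hs
      rw [h] at hs'
      simp only [Complex.neg_re, Complex.natCast_re] at hs'
      have : (0 : ℝ) ≤ m := m.cast_nonneg
      linarith).differentiableWithinAt
  exact hd.analyticAt (hU.mem_nhds (by simp))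

/-- The reflection formula cleared of its pole, so that it can be differentiated at `z = 0`. -/
theorem Gamma_mul_Gamma_mul_sin {z : ℂ} (hz : ‖z‖ < 1) :
    Complex.sin (Real.pi * z) * (Complex.Gamma (1 + z) * Complex.Gamma (1 - z)) =
      z * Real.pi := by
  by_cases h0 : z = 0
  · simp [h0]
  have hpi : (Real.pi : ℂ) ≠ 0 := by exact_mod_cast Real.pi_ne_zero
  have hsin : Complex.sin (Real.pi * z) ≠ 0 := fun h => by
    obtain ⟨k, hk⟩ := Complex.sin_eq_zero_iff.mp h
    have hzk : z = k := mul_left_cancel₀ hpi (by rw [hk]; ring)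
    rw [hzk, Complex.norm_intCast] at hz
    have : |k| < 1 := by exact_mod_cast hz
    exact h0 (by rw [hzk, Int.abs_lt_one_iff.mp this, Int.cast_zero])
  have h := Complex.Gamma_mul_Gamma_one_sub z
  rw [add_comm, Complex.Gamma_add_one z h0, mul_assoc, h]
  field_simp

theorem iteratedDeriv_two_Gamma_one :
    iteratedDeriv 2 Complex.Gamma 1 =
      (Real.eulerMascheroniConstant : ℂ) ^ 2 + (Real.pi : ℂ) ^ 2 / 6 := by
  have hpi : (Real.pi : ℂ) ≠ 0 := by exact_mod_cast Real.pi_ne_zero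
  have hG := analyticAt_Gamma_one
  have ha : AnalyticAt ℂ (fun t : ℂ => Complex.Gamma (1 + t)) 0 :=
    AnalyticAt.fun_comp (by simpa using hG) (by fun_prop)
  have hs : AnalyticAt ℂ (fun t : ℂ => Complex.Gamma (1 - t)) 0 :=
    AnalyticAt.fun_comp (by simpa using hG) (by fun_prop)
  have he : (fun z => Complex.sin (Real.pi * z) * (Complex.Gamma (1 + z) * Complex.Gamma (1 - z)))
      =ᶠ[𝓝 0] fun z => z * (Real.pi : ℂ) := by
    filter_upwards [Metric.ball_mem_nhds (0 : ℂ) one_pos] with z hz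
    exact Gamma_mul_Gamma_mul_sin (by simpa using hz)
  have h := he.iteratedDeriv_eq 3
  have hc : iteratedDeriv 2 (fun _ : ℂ => (Real.pi : ℂ)) 0 = 0 := by
    simp [iteratedDeriv_const]
  rw [iteratedDeriv_three_sin_mul _ (ha.fun_mul hs).contDiffAt, iteratedDeriv_succ_id_mul 2
    contDiffAt_const, hc, iteratedDeriv_two_fun_mul ha.contDiffAt hs.contDiffAt,
    iteratedDeriv_comp_const_sub, iteratedDeriv_comp_const_add, deriv_comp_const_sub,
    deriv_comp_const_add] at h
  simp only [add_zero, sub_zero, Complex.Gamma_one, Complex.hasDerivAt_Gamma_one.deriv,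
    smul_eq_mul] at h
  -- As `Γ'(1) = -γ`, the product `Γ(1+t) Γ(1-t)` has second derivative `2 Γ''(1) - 2γ^2` at `0`, so
  -- `h` reads `3π (2 Γ''(1) - 2γ^2) - π^3 = 0`.
  have h2 : (6 * Real.pi : ℂ) * (iteratedDeriv 2 Complex.Gamma 1 -
      ((Real.eulerMascheroniConstant : ℂ) ^ 2 + (Real.pi : ℂ) ^ 2 / 6)) = 0 := by
    linear_combination h
  have h3 := (mul_eq_zero.mp h2).resolve_left (by simp)
  linear_combination h3

/-- The functional equation at `1 - t`. The factor `t` cancels the pole of `ζ(1 - t)`, making every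
factor on the right analytic at `0`. -/
theorem riemannZeta_mul_id_eq {t : ℂ} (ht : ‖t‖ < 1) :
    t * riemannZeta t = Complex.sin (Real.pi / 2 * t) *
      ((1 / (Real.pi : ℂ) * Complex.exp (Real.log (2 * Real.pi) * t)) *
        (Complex.Gamma (1 - t) * (-1 + t * zetaRegularPart (1 - t)))) := by
  by_cases h0 : t = 0
  · simp [h0]
  have hre : t.re < 1 := (Complex.re_le_norm t).trans_lt ht
  have hpi : (Real.pi : ℂ) ≠ 0 := by exact_mod_cast Real.pi_ne_zero
  have h2pi : (2 * Real.pi : ℂ) ≠ 0 := mul_ne_zero two_ne_zero hpi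
  have h1 : (1 : ℂ) - t ≠ 1 := fun h => h0 (by linear_combination -h)
  have h := riemannZeta_one_sub (s := 1 - t) (fun n hn => by
    have := congrArg Complex.re hn
    simp only [Complex.sub_re, Complex.one_re, Complex.neg_re, Complex.natCast_re] at this
    have : (0 : ℝ) ≤ n := n.cast_nonneg
    linarith) h1
  have hz : t * riemannZeta (1 - t) = -1 + t * zetaRegularPart (1 - t) := by
    rw [zetaRegularPart, Function.update_of_ne h1]
    have : 1 - t - 1 = -t := by ring
    rw [this]
    field_simp
    ring
  have hcos : Complex.cos (Real.pi * (1 - t) / 2) = Complex.sin (Real.pi / 2 * t) := by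
    rw [← Complex.cos_pi_div_two_sub]
    congr 1
    ring
  have hpow : (2 * Real.pi : ℂ) ^ (-(1 - t)) =
      1 / (2 * Real.pi) * Complex.exp (Real.log (2 * Real.pi) * t) := by
    rw [show -(1 - t) = -1 + t by ring, Complex.cpow_add _ _ h2pi, Complex.cpow_neg_one,
      Complex.cpow_def_of_ne_zero h2pi t, Complex.ofReal_log (by positivity)]
    push_cast
    ring
  rw [sub_sub_cancel, hcos, hpow] at h
  rw [← hz, h]
  field_simp

theorem iteratedDeriv_two_riemannZeta_zero :
    iteratedDeriv 2 riemannZeta 0 = stieltjesConstant 1 +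
      (Real.eulerMascheroniConstant : ℂ) ^ 2 / 2 - (Real.pi : ℂ) ^ 2 / 24 -
        (Real.log (2 * Real.pi) : ℂ) ^ 2 / 2 := by
  have hpi : (Real.pi : ℂ) ≠ 0 := by exact_mod_cast Real.pi_ne_zero
  set L : ℂ := (Real.log (2 * Real.pi) : ℂ) with hL
  set E : ℂ → ℂ := fun t => 1 / (Real.pi : ℂ) * Complex.exp (L * t) with hE
  set R : ℂ → ℂ := fun t => zetaRegularPart (1 - t) with hR
  set B : ℂ → ℂ := fun t => -1 + t * R t with hB
  set G : ℂ → ℂ := fun t => Complex.Gamma (1 - t) with hG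
  have hdR : Differentiable ℂ R :=
    differentiable_zetaRegularPart.comp ((differentiable_const 1).sub differentiable_id)
  have hdB : Differentiable ℂ B := (differentiable_const _).add (differentiable_id.mul hdR)
  have hcE {n : ℕ} : ContDiffAt ℂ n E 0 := by
    simp only [hE]
    fun_prop
  have hcG {n : ℕ} : ContDiffAt ℂ n G 0 :=
    (AnalyticAt.fun_comp (by simpa using analyticAt_Gamma_one) (by fun_prop) :
      AnalyticAt ℂ (fun t : ℂ => Complex.Gamma (1 - t)) 0).contDiffAt
  have hcB {n : ℕ} : ContDiffAt ℂ n B 0 := hdB.contDiff.contDiffAt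
  have hcZ : ContDiffAt ℂ (2 + 1 : ℕ) riemannZeta 0 :=
    (differentiableOn_riemannZeta.analyticAt
      (isOpen_compl_singleton.mem_nhds (zero_ne_one (α := ℂ)))).contDiffAt
  have he : (fun t => t * riemannZeta t) =ᶠ[𝓝 0]
      fun t => Complex.sin (Real.pi / 2 * t) * (E t * (G t * B t)) := by
    filter_upwards [Metric.ball_mem_nhds (0 : ℂ) one_pos] with t ht
    exact riemannZeta_mul_id_eq (by simpa using ht)
  have hEn (n : ℕ) : iteratedDeriv n E 0 = L ^ n / Real.pi := by
    rw [hE, iteratedDeriv_const_mul_field, iteratedDeriv_cexp_const_mul]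
    simp
    ring
  have hR0 : R 0 = Real.eulerMascheroniConstant := by simp [hR, zetaRegularPart]
  have hR1 : deriv R 0 = stieltjesConstant 1 := by
    rw [hR, deriv_comp_const_sub, stieltjesConstant, iteratedDeriv_one]
    simp
  have hB0 : B 0 = -1 := by simp [hB]
  have hB1 : deriv B 0 = Real.eulerMascheroniConstant := by
    rw [← iteratedDeriv_one, hB, iteratedDeriv_const_add one_pos]
    refine (iteratedDeriv_succ_id_mul 0 hdR.contDiff.contDiffAt).trans ?_
    simp [hR0]
  have hB2 : iteratedDeriv 2 B 0 = 2 * stieltjesConstant 1 := by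
    rw [hB, iteratedDeriv_const_add two_pos]
    refine (iteratedDeriv_succ_id_mul 1 hdR.contDiff.contDiffAt).trans ?_
    rw [iteratedDeriv_one, hR1]
    norm_num
  have hG0 : G 0 = 1 := by simp [hG]
  have hG1 : deriv G 0 = Real.eulerMascheroniConstant := by
    rw [hG, deriv_comp_const_sub, sub_zero, Complex.hasDerivAt_Gamma_one.deriv, neg_neg]
  have hG2 : iteratedDeriv 2 G 0 =
      (Real.eulerMascheroniConstant : ℂ) ^ 2 + (Real.pi : ℂ) ^ 2 / 6 := by
    rw [hG, iteratedDeriv_comp_const_sub]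
    simp [iteratedDeriv_two_Gamma_one]
  have hGB1 : deriv (fun t => G t * B t) 0 =
      deriv G 0 * B 0 + G 0 * deriv B 0 :=
    deriv_fun_mul (hcG (n := 1) |>.differentiableAt (by simp)) hdB.differentiableAt
  have hE0 : E 0 = 1 / Real.pi := by simp [hE]
  have hE1 : deriv E 0 = L / Real.pi := by
    rw [← iteratedDeriv_one, hEn, pow_one]
  -- The left side yields `3 ζ''(0)`. On the right `(G B)'(0) = -γ + γ = 0`, so no term in `γ log
  -- (2π)` survives.
  have h := he.iteratedDeriv_eq 3
  rw [iteratedDeriv_succ_id_mul 2 hcZ, iteratedDeriv_three_sin_mul _ (hcE.mul (hcG.mul hcB)),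
    iteratedDeriv_two_fun_mul hcE (hcG.mul hcB), iteratedDeriv_two_fun_mul hcG hcB, hGB1, hEn,
    hB2, hG2, hB1, hG1, hE1, hB0, hG0, hE0] at h
  push_cast at h
  field_simp at h
  linear_combination h / 144

end

theorem mainTheorem7 :
    -- the general formula
    (∀ (m : ℕ) (u : ℝ), 1 ≤ m → 0 < u →
      Summable (hasseTerm fun k => (u + k) * Real.log (u + k) ^ m) ∧
      -iteratedDeriv m (hurwitzZetaPos u) 0 + m * iteratedDeriv (m - 1) (hurwitzZetaPos u) 0
        = (-1) ^ m *
          ((∑' n, hasseTerm (fun k => (u + k) * Real.log (u + k) ^ m) n : ℝ) : ℂ)) ∧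
    -- the case `u = 1`
    (∀ m : ℕ, 1 ≤ m →
      Summable (hasseTerm fun k => (1 + k) * Real.log (1 + k) ^ m) ∧
      -iteratedDeriv m riemannZeta 0 + m * iteratedDeriv (m - 1) riemannZeta 0
        = (-1) ^ m *
          ((∑' n, hasseTerm (fun k => (1 + k) * Real.log (1 + k) ^ m) n : ℝ) : ℂ)) ∧
    -- the form with the Stieltjes constants
    (∀ m : ℕ, 1 ≤ m →
      Summable (hasseTerm fun k => k * Real.log (1 + k) ^ m) ∧
      -iteratedDeriv m riemannZeta 0 + m * iteratedDeriv (m - 1) riemannZeta 0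
          + (-1) ^ m * m * stieltjesConstant (m - 1)
        = (-1) ^ m *
          ((∑' n, hasseTerm (fun k => k * Real.log (1 + k) ^ m) n : ℝ) : ℂ)) ∧
    -- the evaluation for `m = 1`
    (Summable (hasseTerm fun k => k * Real.log (1 + k)) ∧
      ∑' n, hasseTerm (fun k => k * Real.log (1 + k)) n
        = Real.eulerMascheroniConstant + 1 / 2 - 1 / 2 * Real.log (2 * Real.pi)) ∧
    -- the evaluation for `m = 2`
    (Summable (hasseTerm fun k => k * Real.log (1 + k) ^ 2) ∧
      ((∑' n, hasseTerm (fun k => k * Real.log (1 + k) ^ 2) n : ℝ) : ℂ)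
        = 1 / 2 * (Real.log (2 * Real.pi) : ℂ) ^ 2 + 1 / 4 * riemannZeta 2
          - 1 / 2 * (Real.eulerMascheroniConstant : ℂ) ^ 2 + stieltjesConstant 1
          - (Real.log (2 * Real.pi) : ℂ)) := by
  have hzero : ∀ m : ℕ, 1 ≤ m →
      Summable (hasseTerm fun k => (1 + k) * Real.log (1 + k) ^ m) ∧
      -iteratedDeriv m riemannZeta 0 + m * iteratedDeriv (m - 1) riemannZeta 0
        = (-1) ^ m *
          ((∑' n, hasseTerm (fun k => (1 + k) * Real.log (1 + k) ^ m) n : ℝ) : ℂ) := fun m hm => by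
    obtain ⟨hs, ht⟩ := summable_and_tsum_of_hasSum_ofReal (hasSum_hasseTerm_mul_log_pow one_pos hm)
    refine ⟨hs, ?_⟩
    rw [ht, ← mul_assoc, neg_one_pow_mul_self, one_mul, hurwitzZetaPos_one]
  refine ⟨fun m u hm hu => ?_, hzero, fun m hm => ?_, ?_, ?_⟩
  · obtain ⟨hs, ht⟩ := summable_and_tsum_of_hasSum_ofReal (hasSum_hasseTerm_mul_log_pow hu hm)
    refine ⟨hs, ?_⟩
    rw [ht, ← mul_assoc, neg_one_pow_mul_self, one_mul]
  · obtain ⟨hs, ht⟩ := summable_and_tsum_of_hasSum_ofReal (hasSum_hasseTerm_index_mul_log_pow hm)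
    refine ⟨hs, ?_⟩
    rw [ht, mul_add, ← mul_assoc, neg_one_pow_mul_self, one_mul, mul_assoc]
  · obtain ⟨hs, ht⟩ :=
      summable_and_tsum_of_hasSum_ofReal (hasSum_hasseTerm_index_mul_log_pow le_rfl)
    simp only [pow_one] at hs ht
    refine ⟨hs, Complex.ofReal_injective ?_⟩
    rw [ht, iteratedDeriv_one, deriv_riemannZeta_zero, Nat.sub_self, iteratedDeriv_zero,
      riemannZeta_zero, stieltjesConstant_zero, Complex.ofReal_sub, Complex.ofReal_mul,
      Complex.ofReal_log (by positivity)]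
    push_cast
    ring
  · obtain ⟨hs, ht⟩ :=
      summable_and_tsum_of_hasSum_ofReal (hasSum_hasseTerm_index_mul_log_pow one_le_two)
    refine ⟨hs, ?_⟩
    rw [ht, iteratedDeriv_two_riemannZeta_zero, show 2 - 1 = 1 from rfl, iteratedDeriv_one,
      deriv_riemannZeta_zero, riemannZeta_two, Complex.ofReal_log (by positivity)]
    push_cast
    ring
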